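/- Work in max algebra over the nonnegative reals ($a\oplus b=\max(a,b)$, $a\otimes b=ab$). Let $N=\{1,\dots,n\}$, let $A=(a_{ij})$ be an $n\times n$ matrix with nonnegative real entries, and let $\lambda\ge 0$. Let $\operatorname{span}(M)=\{\bigoplus_j M_{\cdot j}x_j : x_j\ge 0\}$ be the max-algebraic column span of a nonnegative matrix $M$ (it is $\{0\}$ if $M$ has no columns), let $\operatorname{span}^+(M)$ be the set of its vectors with all entries positive, and let $M^{(s)}$ be $M$ with its column of index $s$ removed. Let $V(A,\lambda)=\{x\ge 0: \max_j a_{ij}x_j=\lambda x_i \text{ for all } i\}$, let $V^+(A,\lambda)$ be the set of its vectors with all entries positive, and let $N^\lambda$ be the greatest support of a vector of $V(A,\lambda)$. The digraph of $A$ has node set $N$ and an edge $(i,j)$ whenever $a_{ij}>0$. The critical graph $\mathrm{Crit}(A,\lambda)$ consists of all nodes and edges of the (elementary) cycles $(i_1,\dots,i_k,i_1)$ of this digraph with all nodes in $N^\lambda$ and with geometric mean $(a_{i_1i_2}a_{i_2i_3}\cdots a_{i_ki_1})^{1/k}=\lambda$; let $N_c(A,\lambda)$ be its node set. Let $K$ be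 the set of the smallest indices of the strongly connected components of $\mathrm{Crit}(A,\lambda)$. Let $A_\lambda$ be the matrix whose $i$-th column is $A_{\cdot i}/\lambda$ if $i\in N^\lambda$ and $0$ otherwise, let $A_\lambda^+=\bigoplus_{k\ge1}A_\lambda^{\otimes k}$, and let the generating matrix $G_{A,\lambda}$ consist of the columns of $A_\lambda^+$ with indices in $K$. Theorem. Suppose that $N_c(A,\lambda)=N$ and that every strongly connected component of $\mathrm{Crit}(A,\lambda)$ is a cycle (possibly a loop). Then $$\Bigl(\bigcup_{i\in N}\operatorname{span}(A^{(i)})\Bigr)\cap V^+(A,\lambda)=\bigcup_{s\in K}\operatorname{span}^+\bigl(G_{A,\lambda}^{(s)}\bigr).$$ -/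

import Mathlib

open scoped NNReal

namespace MaxAlg

/-- Max-algebraic matrix-vector product: `(A ⊗ x)_i = max_j a_ij x_j`
(the empty maximum is `0`). -/
noncomputable def mulVec {m ι : Type*} [Fintype ι] (A : Matrix m ι ℝ≥0) (x : ι → ℝ≥0) :
    m → ℝ≥0 :=
  fun i => Finset.univ.sup fun j => A i j * x j

/-- Max-algebraic matrix product: `(A ⊗ B)_ij = max_l a_il b_lj`. -/
noncomputable def mul {m ι p : Type*} [Fintype ι] (A : Matrix m ι ℝ≥0) (B : Matrix ι p ℝ≥0) :
    Matrix m p ℝ≥0 :=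
  fun i j => Finset.univ.sup fun l => A i l * B l j

/-- Max-algebraic column span of `A`: all max-linear combinations of the columns with
nonnegative coefficients. -/
def span {m ι : Type*} [Fintype ι] (A : Matrix m ι ℝ≥0) : Set (m → ℝ≥0) :=
  {y | ∃ x : ι → ℝ≥0, y = mulVec A x}

/-- The positive vectors (all entries positive) of the column span. -/
def posSpan {m ι : Type*} [Fintype ι] (A : Matrix m ι ℝ≥0) : Set (m → ℝ≥0) :=
  {y | y ∈ span A ∧ ∀ i, 0 < y i}

/-- The matrix that remains after the column with index `s` of `A` is removed. -/
def removeCol {m ι : Type*} (A : Matrix m ι ℝ≥0) (s : ι) : Matrix m {j : ι // j ≠ s} ℝ≥0 :=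
  fun i j => A i j.1

variable {n : ℕ}

/-- The max-algebraic powers `A^{⊗k}`. -/
noncomputable def pow (A : Matrix (Fin n) (Fin n) ℝ≥0) : ℕ → Matrix (Fin n) (Fin n) ℝ≥0
  | 0 => 1
  | k + 1 => mul (pow A k) A

/-- The series `A⁺ = ⨁_{k ≥ 1} A^{⊗k}` (entrywise supremum). It is only used for matrices for
which these suprema are finite, see `bddAbove_pow_scaled`. -/
noncomputable def plus (A : Matrix (Fin n) (Fin n) ℝ≥0) : Matrix (Fin n) (Fin n) ℝ≥0 :=
  fun i j => ⨆ k : ℕ, pow A (k + 1) i j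

/-- The eigencone `V(A, lam) = {x | A ⊗ x = lam x}`. -/
def eigencone (A : Matrix (Fin n) (Fin n) ℝ≥0) (lam : ℝ≥0) : Set (Fin n → ℝ≥0) :=
  {x | mulVec A x = fun i => lam * x i}

/-- The positive vectors of the eigencone. -/
def posEigencone (A : Matrix (Fin n) (Fin n) ℝ≥0) (lam : ℝ≥0) : Set (Fin n → ℝ≥0) :=
  {x | x ∈ eigencone A lam ∧ ∀ i, 0 < x i}

/-- The greatest support `N^lam` of a vector of the eigencone, as the union of all supports;
by `exists_support_eq` it is itself the support of a vector of the eigencone. -/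
def maxSupport (A : Matrix (Fin n) (Fin n) ℝ≥0) (lam : ℝ≥0) : Set (Fin n) :=
  {i | ∃ x ∈ eigencone A lam, 0 < x i}

/-- `c = (c 0, …, c k)` is an (elementary) cycle `c 0 → c 1 → ⋯ → c k → c 0` of length `k + 1` in
the digraph of `A` (edges `i → j` for `a_ij > 0`), with all its nodes in `S`. The addition in
`Fin (k + 1)` is cyclic. -/
def IsCycleIn (A : Matrix (Fin n) (Fin n) ℝ≥0) (S : Set (Fin n)) {k : ℕ}
    (c : Fin (k + 1) → Fin n) : Prop :=
  Function.Injective c ∧ (∀ l, 0 < A (c l) (c (l + 1))) ∧ ∀ l, c l ∈ S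

/-- Geometric mean of the weights of the edges of a cycle. -/
noncomputable def geomMean (A : Matrix (Fin n) (Fin n) ℝ≥0) {k : ℕ}
    (c : Fin (k + 1) → Fin n) : ℝ≥0 :=
  (∏ l, A (c l) (c (l + 1))) ^ (((k + 1 : ℕ) : ℝ)⁻¹)

/-- Critical cycles for `lam`: the cycles of the digraph of `A` restricted to the nodes in
`N^lam` whose geometric mean is `lam`. -/
def IsCritCycle (A : Matrix (Fin n) (Fin n) ℝ≥0) (lam : ℝ≥0) {k : ℕ}
    (c : Fin (k + 1) → Fin n) : Prop :=
  IsCycleIn A (maxSupport A lam) c ∧ geomMean A c = lam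

/-- The set `N_c(A, lam)` of nodes of the critical graph `Crit(A, lam)`. -/
def critNodes (A : Matrix (Fin n) (Fin n) ℝ≥0) (lam : ℝ≥0) : Set (Fin n) :=
  {i | ∃ (k : ℕ) (c : Fin (k + 1) → Fin n), IsCritCycle A lam c ∧ ∃ l, c l = i}

/-- The edge relation of the critical graph `Crit(A, lam)`. -/
def CritEdge (A : Matrix (Fin n) (Fin n) ℝ≥0) (lam : ℝ≥0) (i j : Fin n) : Prop :=
  ∃ (k : ℕ) (c : Fin (k + 1) → Fin n), IsCritCycle A lam c ∧ ∃ l, c l = i ∧ c (l + 1) = j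

/-- The node set of the strongly connected component of `i` in the critical graph. -/
def critComponent (A : Matrix (Fin n) (Fin n) ℝ≥0) (lam : ℝ≥0) (i : Fin n) : Set (Fin n) :=
  {j | j ∈ critNodes A lam ∧ Relation.ReflTransGen (CritEdge A lam) i j ∧
    Relation.ReflTransGen (CritEdge A lam) j i}

/-- The subgraph of the critical graph on the node set `C` is a cycle: its nodes can be listed
without repetition as `c 0, …, c k` so that its edges are exactly
`c 0 → c 1 → ⋯ → c k → c 0`. -/
def IsCycleComponent (A : Matrix (Fin n) (Fin n) ℝ≥0) (lam : ℝ≥0) (C : Set (Fin n)) : Prop :=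
  ∃ (k : ℕ) (c : Fin (k + 1) → Fin n), Function.Injective c ∧ Set.range c = C ∧
    ∀ i ∈ C, ∀ j ∈ C, (CritEdge A lam i j ↔ ∃ l, c l = i ∧ c (l + 1) = j)

open Classical in
/-- The matrix `A_lam`: column `j` is `A_{·j} / lam` for `j ∈ N^lam`, and `0` otherwise. -/
noncomputable def scaled (A : Matrix (Fin n) (Fin n) ℝ≥0) (lam : ℝ≥0) :
    Matrix (Fin n) (Fin n) ℝ≥0 :=
  fun i j => if j ∈ maxSupport A lam then A i j / lam else 0

open Classical in
/-- The set `K` of the first (smallest) indices of the strongly connected components of the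
critical graph. -/
noncomputable def firstIndices (A : Matrix (Fin n) (Fin n) ℝ≥0) (lam : ℝ≥0) : Finset (Fin n) :=
  Finset.univ.filter fun j => j ∈ critNodes A lam ∧ ∀ i ∈ critComponent A lam j, j ≤ i

/-- The generating matrix `G_{A, lam}`: its columns are the columns of `(A_lam)⁺` with indices
in `K`. -/
noncomputable def genMatrix (A : Matrix (Fin n) (Fin n) ℝ≥0) (lam : ℝ≥0) :
    Matrix (Fin n) (firstIndices A lam) ℝ≥0 :=
  fun i s => plus (scaled A lam) i s.1

/-- There is a vector of the eigencone with support `N^lam`. -/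
theorem exists_support_eq (A : Matrix (Fin n) (Fin n) ℝ≥0) (lam : ℝ≥0) :
    ∃ x ∈ eigencone A lam, {i | 0 < x i} = maxSupport A lam := by
  classical
  have h : ∀ i, ∃ x ∈ eigencone A lam, i ∈ maxSupport A lam → 0 < x i := by
    intro i
    by_cases hi : i ∈ maxSupport A lam
    · obtain ⟨x, hx, hxi⟩ := hi
      exact ⟨x, hx, fun _ => hxi⟩
    · refine ⟨0, ?_, fun h => absurd h hi⟩
      funext i
      simp [mulVec]
  choose f hf hpos using h
  have hmem : (fun i => Finset.univ.sup fun t => f t i) ∈ eigencone A lam := by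
    funext i
    simp only [mulVec, NNReal.mul_finset_sup]
    rw [Finset.sup_comm]
    refine Finset.sup_congr rfl fun t _ => ?_
    exact congrFun (hf t) i
  refine ⟨_, hmem, ?_⟩
  ext i
  refine ⟨fun hi => ⟨_, hmem, hi⟩, fun hi => lt_of_lt_of_le (hpos i hi) ?_⟩
  exact Finset.le_sup (f := fun t => f t i) (Finset.mem_univ i)

/-- The suprema that define `(A_lam)⁺` are finite. -/
theorem bddAbove_pow_scaled (A : Matrix (Fin n) (Fin n) ℝ≥0) (lam : ℝ≥0) (i j : Fin n) :
    BddAbove (Set.range fun k : ℕ => pow (scaled A lam) (k + 1) i j) := by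
  classical
  obtain ⟨x, hx, hs⟩ := exists_support_eq A lam
  have hstep : ∀ a b, scaled A lam a b * x b ≤ x a := by
    intro a b
    unfold scaled
    split_ifs with hb
    · rcases eq_or_ne lam 0 with h0 | h0
      · simp [h0]
      · have h1 : A a b * x b ≤ lam * x a := by
          rw [← congrFun hx a]
          exact Finset.le_sup (f := fun t => A a t * x t) (Finset.mem_univ b)
        rw [div_mul_eq_mul_div]
        exact div_le_of_le_mul₀ (zero_le) (zero_le) (by rwa [mul_comm lam] at h1)
    · simp
  have hpow : ∀ k a b, pow (scaled A lam) k a b * x b ≤ x a := by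
    intro k
    induction k with
    | zero =>
      intro a b
      by_cases hab : a = b
      · subst hab; simp [pow]
      · simp [pow, Matrix.one_apply_ne hab]
    | succ k ih =>
      intro a b
      simp only [pow, mul, NNReal.finset_sup_mul]
      refine Finset.sup_le fun l _ => ?_
      calc _ = pow (scaled A lam) k a l * (scaled A lam l b * x b) := by ring
        _ ≤ pow (scaled A lam) k a l * x l := by gcongr; exact hstep l b
        _ ≤ x a := ih a l
  by_cases hj : j ∈ maxSupport A lam
  · have hxj : 0 < x j := by rw [← hs] at hj; exact hj
    refine ⟨x i / x j, ?_⟩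
    rintro _ ⟨k, rfl⟩
    exact (le_div_iff₀ hxj).2 (hpow (k + 1) i j)
  · refine ⟨0, ?_⟩
    rintro _ ⟨k, rfl⟩
    simp [pow, mul, scaled, hj]

end MaxAlg

namespace MaxAlg

/-! For a positive eigenvector `x`, both sides turn out to say the same thing: some saturated edge
leads from one component of the critical graph to another. Multiplying `A i j * x j ≤ lam * x i`
around a cycle shows that critical edges are saturated, and that elementary saturated cycles are
critical. Hence a component that is a cycle has no saturated edges inside it except its own
(`CritEdge.eq_of_saturated`).

If `x` is spanned without column `i`, the critical predecessor `k` of `i` must attain its row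
maximum elsewhere, along a saturated edge that leaves the cycle. Conversely, if such an edge leaves
`k`, the column of the critical successor of `k` is dispensable, since every other row has its own
critical successor.

On the generator side, entries of `(A_lam)⁺` are greatest walk weights. Dropping generator `s` is
possible exactly when every node can reach another generator along saturated edges. A saturated exit
from the component of `s` allows this, and without any exit `plus_mul_lt_of_no_saturated_exit`
forbids it. -/

/-- The edge `i → j` is saturated by `x`: it attains `lam * x i` in row `i` of `A ⊗ x`. -/
def Saturated (A : Matrix (Fin n) (Fin n) ℝ≥0) (lam : ℝ≥0) (x : Fin n → ℝ≥0) (i j : Fin n) :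
    Prop :=
  A i j * x j = lam * x i

/-- Positivity excludes the empty index set, whose maximum is `0`; removing a column may leave none.
-/
theorem exists_eq_of_eq_sup {ι : Type*} [Fintype ι] {f : ι → ℝ≥0} {a : ℝ≥0} (ha : 0 < a)
    (h : a = Finset.univ.sup f) : ∃ j, f j = a := by
  have hne : (Finset.univ : Finset ι).Nonempty := by
    by_contra hne
    rw [Finset.not_nonempty_iff_eq_empty] at hne
    rw [hne, Finset.sup_empty] at h
    exact ha.ne' h
  obtain ⟨j, -, hj⟩ := Finset.exists_mem_eq_sup Finset.univ hne f
  exact ⟨j, by rw [h, hj]⟩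

theorem le_mulVec {m ι : Type*} [Fintype ι] (M : Matrix m ι ℝ≥0) (z : ι → ℝ≥0) (i : m) (j : ι) :
    M i j * z j ≤ mulVec M z i :=
  Finset.le_sup (f := fun j => M i j * z j) (Finset.mem_univ j)

variable {A : Matrix (Fin n) (Fin n) ℝ≥0} {lam : ℝ≥0} {x : Fin n → ℝ≥0}

theorem mul_le_of_mem_eigencone (hx : x ∈ eigencone A lam) (i j : Fin n) :
    A i j * x j ≤ lam * x i := by
  rw [← congrFun hx i]
  exact Finset.le_sup (f := fun t => A i t * x t) (Finset.mem_univ j)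

/-! ### Critical cycles and saturated edges -/

theorem IsCritCycle.prod_eq {k : ℕ} {c : Fin (k + 1) → Fin n} (hc : IsCritCycle A lam c) :
    ∏ l, A (c l) (c (l + 1)) = lam ^ (k + 1) := by
  rw [← hc.2, geomMean, ← NNReal.rpow_natCast, ← NNReal.rpow_mul, inv_mul_cancel₀, NNReal.rpow_one]
  positivity

theorem IsCritCycle.lam_pos {k : ℕ} {c : Fin (k + 1) → Fin n} (hc : IsCritCycle A lam c) :
    0 < lam := by
  rw [← hc.2, geomMean]
  exact NNReal.rpow_pos (Finset.prod_pos fun l _ => hc.1.2.1 l)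

theorem prod_cyclic_shift {k : ℕ} (f : Fin (k + 1) → ℝ≥0) : ∏ l, f (l + 1) = ∏ l, f l :=
  Equiv.prod_comp (Equiv.addRight (1 : Fin (k + 1))) f

/-- Multiply the eigenvector inequalities around the cycle: the entries of `x` cancel and the two
products agree, so no factor can be strict. -/
theorem IsCritCycle.saturated {k : ℕ} {c : Fin (k + 1) → Fin n} (hc : IsCritCycle A lam c)
    (hx : x ∈ eigencone A lam) (hpos : ∀ i, 0 < x i) (l : Fin (k + 1)) :
    Saturated A lam x (c l) (c (l + 1)) := by
  by_contra hne
  have hlt : ∏ l, A (c l) (c (l + 1)) * x (c (l + 1)) < ∏ l, lam * x (c l) :=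
    Finset.prod_lt_prod (fun l _ => mul_pos (hc.1.2.1 l) (hpos _))
      (fun l _ => mul_le_of_mem_eigencone hx _ _)
      ⟨l, Finset.mem_univ l, lt_of_le_of_ne (mul_le_of_mem_eigencone hx _ _) hne⟩
  rw [Finset.prod_mul_distrib, Finset.prod_mul_distrib, hc.prod_eq,
    prod_cyclic_shift fun l => x (c l)] at hlt
  simp at hlt

theorem CritEdge.saturated {i j : Fin n} (h : CritEdge A lam i j)
    (hx : x ∈ eigencone A lam) (hpos : ∀ i, 0 < x i) : Saturated A lam x i j := by
  obtain ⟨k, c, hc, l, rfl, rfl⟩ := h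
  exact hc.saturated hx hpos l

/-- An elementary cycle of saturated edges is critical. -/
theorem isCritCycle_of_saturated {k : ℕ} {c : Fin (k + 1) → Fin n} (hinj : Function.Injective c)
    (hlam : 0 < lam) (hx : x ∈ eigencone A lam) (hpos : ∀ i, 0 < x i)
    (hsat : ∀ l, Saturated A lam x (c l) (c (l + 1))) : IsCritCycle A lam c := by
  have hprod : ∏ l, A (c l) (c (l + 1)) = lam ^ (k + 1) := by
    have h : ∏ l, A (c l) (c (l + 1)) * x (c (l + 1)) = ∏ l, lam * x (c l) :=
      Finset.prod_congr rfl fun l _ => hsat l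
    rw [Finset.prod_mul_distrib, Finset.prod_mul_distrib,
      prod_cyclic_shift fun l => x (c l)] at h
    simpa using mul_right_cancel₀ (Finset.prod_pos fun l _ => hpos (c l)).ne' h
  refine ⟨⟨hinj, fun l => ?_, fun l => ⟨x, hx, hpos _⟩⟩, ?_⟩
  · have h : 0 < A (c l) (c (l + 1)) * x (c (l + 1)) := by
      rw [hsat l]
      exact mul_pos hlam (hpos _)
    exact pos_of_mul_pos_left h zero_le
  · rw [geomMean, hprod, ← NNReal.rpow_natCast, ← NNReal.rpow_mul, mul_inv_cancel₀,
      NNReal.rpow_one]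
    positivity

open scoped Fin.CommRing in
/-- A node of a cyclic sequence is joined to each other one, by going around. -/
theorem reflTransGen_of_cyclic {k : ℕ} {α : Type*} {r : α → α → Prop} {c : Fin (k + 1) → α}
    (h : ∀ l, r (c l) (c (l + 1))) (a b : Fin (k + 1)) : Relation.ReflTransGen r (c a) (c b) := by
  have key : ∀ m : ℕ, Relation.ReflTransGen r (c a) (c (a + (m : Fin (k + 1)))) := by
    intro m
    induction m with
    | zero => simpa using Relation.ReflTransGen.refl
    | succ m ih =>
      refine ih.tail ?_
      have := h (a + (m : Fin (k + 1)))
      rwa [Nat.cast_succ, ← add_assoc]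
  simpa using key (b - a).val

/-- The rest of the critical cycle leads back, so critical edges never leave a component. -/
theorem CritEdge.reflTransGen_symm {i j : Fin n} (h : CritEdge A lam i j) :
    Relation.ReflTransGen (CritEdge A lam) j i := by
  obtain ⟨k, c, hc, l, rfl, rfl⟩ := h
  exact reflTransGen_of_cyclic (fun l => ⟨k, c, hc, l, rfl, rfl⟩) _ _

theorem exists_critEdge_left {i : Fin n} (hi : i ∈ critNodes A lam) :
    ∃ j, CritEdge A lam i j := by
  obtain ⟨k, c, hc, l, rfl⟩ := hi
  exact ⟨_, k, c, hc, l, rfl, rfl⟩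

theorem exists_critEdge_right {i : Fin n} (hi : i ∈ critNodes A lam) :
    ∃ j, CritEdge A lam j i := by
  obtain ⟨k, c, hc, l, rfl⟩ := hi
  exact ⟨_, k, c, hc, l - 1, rfl, by rw [sub_add_cancel]⟩

/-! ### Strongly connected components of the critical graph -/

theorem self_mem_critComponent {i : Fin n} (hi : i ∈ critNodes A lam) :
    i ∈ critComponent A lam i :=
  ⟨hi, .refl, .refl⟩

theorem mem_critComponent_symm {i j : Fin n} (hi : i ∈ critNodes A lam)
    (h : j ∈ critComponent A lam i) : i ∈ critComponent A lam j :=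
  ⟨hi, h.2.2, h.2.1⟩

theorem mem_critComponent_trans {i j k : Fin n} (hij : j ∈ critComponent A lam i)
    (hjk : k ∈ critComponent A lam j) : k ∈ critComponent A lam i :=
  ⟨hjk.1, hij.2.1.trans hjk.2.1, hjk.2.2.trans hij.2.2⟩

theorem CritEdge.mem_critNodes_right {i j : Fin n} (h : CritEdge A lam i j) :
    j ∈ critNodes A lam := by
  obtain ⟨k, c, hc, l, -, rfl⟩ := h
  exact ⟨k, c, hc, _, rfl⟩

theorem CritEdge.mem_critNodes_left {i j : Fin n} (h : CritEdge A lam i j) :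
    i ∈ critNodes A lam := by
  obtain ⟨k, c, hc, l, rfl, -⟩ := h
  exact ⟨k, c, hc, _, rfl⟩

theorem CritEdge.mem_critComponent {i j : Fin n} (h : CritEdge A lam i j) :
    j ∈ critComponent A lam i :=
  ⟨h.mem_critNodes_right, .single h, h.reflTransGen_symm⟩

theorem mem_firstIndices {s : Fin n} :
    s ∈ firstIndices A lam ↔ s ∈ critNodes A lam ∧ ∀ i ∈ critComponent A lam s, s ≤ i := by
  simp [firstIndices]

theorem exists_firstIndex {i : Fin n} (hi : i ∈ critNodes A lam) :
    ∃ s ∈ firstIndices A lam, s ∈ critComponent A lam i := by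
  classical
  obtain ⟨s, hs, hmin⟩ := Finset.exists_min_image
    (Finset.univ.filter fun j => j ∈ critComponent A lam i) id
    ⟨i, by simpa using self_mem_critComponent hi⟩
  have hs' : s ∈ critComponent A lam i := by simpa using hs
  refine ⟨s, ?_, hs'⟩
  exact mem_firstIndices.2 ⟨hs'.1, fun j hj =>
    hmin j (by simpa using mem_critComponent_trans hs' hj)⟩

theorem mem_critNodes_of_mem_firstIndices {s : Fin n} (hs : s ∈ firstIndices A lam) :
    s ∈ critNodes A lam :=
  (mem_firstIndices.1 hs).1

theorem firstIndices_eq_of_mem_critComponent {s t : Fin n} (hs : s ∈ firstIndices A lam)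
    (ht : t ∈ firstIndices A lam) (h : t ∈ critComponent A lam s) : s = t := by
  have h' := mem_critComponent_symm (mem_critNodes_of_mem_firstIndices hs) h
  exact le_antisymm ((mem_firstIndices.1 hs).2 t h) ((mem_firstIndices.1 ht).2 s h')

open scoped Fin.CommRing in
/-- In a component that is a cycle, the only saturated edge from a node to a node of the same
component is the critical one. -/
theorem CritEdge.eq_of_saturated {i j k : Fin n}
    (hcyc : IsCycleComponent A lam (critComponent A lam k))
    (hx : x ∈ eigencone A lam) (hpos : ∀ i, 0 < x i) (hki : CritEdge A lam k i)
    (hkj : Saturated A lam x k j) (hj : j ∈ critComponent A lam k) : i = j := by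
  have hk := self_mem_critComponent hki.mem_critNodes_left
  have hi := hki.mem_critComponent
  obtain ⟨m, c, hinj, hrange, hedge⟩ := hcyc
  obtain ⟨l, hl, hl'⟩ := (hedge k hk i hi).1 hki
  have hmem : ∀ l, c l ∈ critComponent A lam k := fun l => hrange ▸ Set.mem_range_self l
  have hsat : ∀ l, Saturated A lam x (c l) (c (l + 1)) := fun l =>
    ((hedge _ (hmem l) _ (hmem _)).2 ⟨l, rfl, rfl⟩).saturated hx hpos
  obtain ⟨b, rfl⟩ : ∃ b, c b = j := by rwa [← hrange] at hj
  suffices CritEdge A lam k (c b) by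
    obtain ⟨l', h1, h2⟩ := (hedge k hk _ hj).1 this
    rw [← hl', ← h2, hinj (hl.trans h1.symm)]
  have hlam : 0 < lam := by
    obtain ⟨_, _, hc, _⟩ := hki
    exact hc.lam_pos
  -- Going forward from `c b`, `p` steps reach `c l = k`. The edge `k → c b` closes this arc to an
  -- elementary saturated cycle, which makes that edge critical.
  set p := (l - b).val
  have hpm : p < m + 1 := (l - b).isLt
  have hlast : b + ((p : ℕ) : Fin (m + 1)) = l := by simp [p]
  have hcrit : IsCritCycle A lam
      (fun q : Fin (p + 1) => c (b + ((q.val : ℕ) : Fin (m + 1)))) := by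
    refine isCritCycle_of_saturated ?_ hlam hx hpos ?_
    · intro q r hqr
      have h := congrArg Fin.val (add_left_cancel (hinj hqr))
      rw [Fin.val_natCast, Fin.val_natCast, Nat.mod_eq_of_lt (by omega),
        Nat.mod_eq_of_lt (by omega)] at h
      exact Fin.ext h
    · intro q
      by_cases hq : q = Fin.last p
      · subst hq
        simpa only [Fin.val_last, hlast, hl, Fin.last_add_one, Fin.val_zero, Nat.cast_zero,
          add_zero] using hkj
      · have hv : (q + 1).val = q.val + 1 := Fin.val_add_one_of_lt (Fin.lt_last_iff_ne_last.2 hq)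
        simp only [hv, Nat.cast_succ, ← add_assoc]
        exact hsat _
  refine ⟨p, _, hcrit, Fin.last p, ?_, ?_⟩
  · simp [hlast, hl]
  · simp

/-- In a component that is a cycle, each node has only one critical predecessor. -/
theorem CritEdge.left_unique {i k p : Fin n}
    (hcyc : IsCycleComponent A lam (critComponent A lam i))
    (hk : CritEdge A lam k i) (hp : CritEdge A lam p i) : p = k := by
  have hi := self_mem_critComponent hk.mem_critNodes_right
  obtain ⟨m, c, hinj, hrange, hedge⟩ := hcyc
  obtain ⟨l, rfl, hl⟩ := (hedge k (mem_critComponent_symm hk.mem_critNodes_left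
    hk.mem_critComponent) i hi).1 hk
  obtain ⟨l', rfl, hl'⟩ := (hedge p (mem_critComponent_symm hp.mem_critNodes_left
    hp.mem_critComponent) i hi).1 hp
  rw [add_right_cancel (hinj (hl'.trans hl.symm))]

/-! ### The matrix `(A_lam)⁺` -/

theorem scaled_mul_le (hx : x ∈ eigencone A lam) (i j : Fin n) :
    scaled A lam i j * x j ≤ x i := by
  unfold scaled
  split_ifs
  · rw [div_mul_eq_mul_div]
    refine div_le_of_le_mul₀ zero_le zero_le ?_
    rw [mul_comm (x i)]
    exact mul_le_of_mem_eigencone hx i j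
  · simp

theorem Saturated.scaled_mul_eq {i j : Fin n} (h : Saturated A lam x i j) (hlam : 0 < lam)
    (hx : x ∈ eigencone A lam) (hpos : ∀ i, 0 < x i) : scaled A lam i j * x j = x i := by
  have hj : j ∈ maxSupport A lam := ⟨x, hx, hpos j⟩
  rw [scaled, if_pos hj, div_mul_eq_mul_div, h, mul_div_cancel_left₀ _ hlam.ne']

theorem saturated_of_scaled_mul_eq {i j : Fin n} (h : scaled A lam i j * x j = x i)
    (hlam : 0 < lam) (hx : x ∈ eigencone A lam) (hpos : ∀ i, 0 < x i) :
    Saturated A lam x i j := by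
  have hj : j ∈ maxSupport A lam := ⟨x, hx, hpos j⟩
  rw [scaled, if_pos hj, div_mul_eq_mul_div, div_eq_iff hlam.ne'] at h
  rw [Saturated, h, mul_comm]

theorem pow_succ_apply_ge (B : Matrix (Fin n) (Fin n) ℝ≥0) (k : ℕ) (i l j : Fin n) :
    pow B k i l * B l j ≤ pow B (k + 1) i j :=
  Finset.le_sup (f := fun l => pow B k i l * B l j) (Finset.mem_univ l)

theorem pow_one_apply (B : Matrix (Fin n) (Fin n) ℝ≥0) (i j : Fin n) :
    pow B (0 + 1) i j = B i j := by
  refine le_antisymm ?_ ?_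
  · rw [pow, mul]
    refine Finset.sup_le fun l _ => ?_
    by_cases h : i = l
    · subst h; simp [pow]
    · simp [pow, Matrix.one_apply_ne h]
  · simpa [pow] using pow_succ_apply_ge B 0 i i j

/-- Powers grow on the right, but the eigenvector equation for columns of `(A_lam)⁺` multiplies on
the left. -/
theorem pow_succ_left (B : Matrix (Fin n) (Fin n) ℝ≥0) (k : ℕ) (i j : Fin n) :
    pow B (k + 1 + 1) i j = Finset.univ.sup fun l => B i l * pow B (k + 1) l j := by
  induction k generalizing j with
  | zero =>
    change (Finset.univ.sup fun l => pow B (0 + 1) i l * B l j) = _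
    simp only [pow_one_apply]
  | succ k ih =>
    calc pow B (k + 1 + 1 + 1) i j
        = Finset.univ.sup fun l => pow B (k + 1 + 1) i l * B l j := rfl
      _ = Finset.univ.sup fun l => Finset.univ.sup fun p =>
            B i p * pow B (k + 1) p l * B l j := by
          simp only [ih, NNReal.finset_sup_mul]
      _ = Finset.univ.sup fun p => Finset.univ.sup fun l =>
            B i p * pow B (k + 1) p l * B l j := Finset.sup_comm _ _ _
      _ = Finset.univ.sup fun p => B i p * pow B (k + 1 + 1) p j := by
          refine Finset.sup_congr rfl fun p _ => ?_
          change _ = B i p * Finset.univ.sup fun l => pow B (k + 1) p l * B l j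
          rw [NNReal.mul_finset_sup]
          simp only [mul_assoc]

theorem pow_le_plus (k : ℕ) (i j : Fin n) :
    pow (scaled A lam) (k + 1) i j ≤ plus (scaled A lam) i j :=
  le_ciSup (bddAbove_pow_scaled A lam i j) k

theorem pow_scaled_mul_le (hx : x ∈ eigencone A lam) (k : ℕ) (i j : Fin n) :
    pow (scaled A lam) (k + 1) i j * x j ≤ x i := by
  induction k generalizing j with
  | zero => rw [pow_one_apply]; exact scaled_mul_le hx i j
  | succ k ih =>
    rw [pow, mul, NNReal.finset_sup_mul]
    refine Finset.sup_le fun l _ => ?_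
    calc _ = pow (scaled A lam) (k + 1) i l * (scaled A lam l j * x j) := mul_assoc _ _ _
      _ ≤ pow (scaled A lam) (k + 1) i l * x l := by gcongr; exact scaled_mul_le hx l j
      _ ≤ x i := ih l

theorem plus_mul_le {i j : Fin n} {b : ℝ≥0} (hxj : 0 < x j)
    (h : ∀ k, pow (scaled A lam) (k + 1) i j * x j ≤ b) : plus (scaled A lam) i j * x j ≤ b := by
  rw [← le_div_iff₀ hxj]
  exact ciSup_le fun k => (le_div_iff₀ hxj).2 (h k)

/-- Along a saturated walk the inequalities `scaled A lam i j * x j ≤ x i` are equalities and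
telescope. -/
theorem le_plus_mul_of_transGen (hlam : 0 < lam) (hx : x ∈ eigencone A lam)
    (hpos : ∀ i, 0 < x i) {i j : Fin n} (h : Relation.TransGen (Saturated A lam x) i j) :
    x i ≤ plus (scaled A lam) i j * x j := by
  obtain ⟨k, hk⟩ : ∃ k, x i ≤ pow (scaled A lam) (k + 1) i j * x j := by
    induction h with
    | single h => exact ⟨0, by rw [pow_one_apply, h.scaled_mul_eq hlam hx hpos]⟩
    | @tail l j _ h ih =>
      obtain ⟨k, hk⟩ := ih
      refine ⟨k + 1, hk.trans ?_⟩
      rw [← h.scaled_mul_eq hlam hx hpos, ← mul_assoc]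
      gcongr
      exact pow_succ_apply_ge _ _ _ _ _
  exact hk.trans (by gcongr; exact pow_le_plus k i j)

/-- If no saturated edge leaves `C`, then the entries of `(A_lam)⁺` from `C` to its complement
are not saturated either. -/
theorem plus_mul_lt_of_no_saturated_exit (hlam : 0 < lam) (hx : x ∈ eigencone A lam)
    (hpos : ∀ i, 0 < x i) {C : Set (Fin n)}
    (hC : ∀ k ∈ C, ∀ j ∉ C, ¬ Saturated A lam x k j) {s t : Fin n} (hs : s ∈ C) (ht : t ∉ C) :
    plus (scaled A lam) s t * x t < x s := by
  classical
  -- A uniform factor is needed: strictness for each power could be lost in the infinite supremum.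
  -- There are only finitely many exit edges, so their greatest ratio is below `1`.
  obtain ⟨θ, hθ, hexit⟩ : ∃ θ : ℝ≥0, θ < 1 ∧
      ∀ k ∈ C, ∀ j ∉ C, scaled A lam k j * x j ≤ θ * x k := by
    refine ⟨Finset.univ.sup fun e : Fin n × Fin n =>
      if e.1 ∈ C ∧ e.2 ∉ C then scaled A lam e.1 e.2 * x e.2 / x e.1 else 0, ?_, ?_⟩
    · rw [Finset.sup_lt_iff (by simp)]
      intro e _
      split_ifs with h
      · rw [div_lt_one₀ (hpos _)]
        exact lt_of_le_of_ne (scaled_mul_le hx _ _) fun h' =>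
          hC _ h.1 _ h.2 (saturated_of_scaled_mul_eq h' hlam hx hpos)
      · exact one_pos
    · intro k hk j hj
      rw [← div_le_iff₀ (hpos k)]
      refine le_trans (le_of_eq ?_) (Finset.le_sup (Finset.mem_univ (k, j)))
      rw [if_pos ⟨hk, hj⟩]
  have hpow : ∀ m, ∀ j ∉ C, pow (scaled A lam) (m + 1) s j * x j ≤ θ * x s := by
    intro m
    induction m with
    | zero => intro j hj; rw [pow_one_apply]; exact hexit s hs j hj
    | succ m ih =>
      intro j hj
      rw [pow, mul, NNReal.finset_sup_mul]
      refine Finset.sup_le fun l _ => ?_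
      rw [mul_assoc]
      -- Either the last edge is an exit and contributes `θ`, or the walk had already left `C`.
      by_cases hl : l ∈ C
      · calc _ ≤ pow (scaled A lam) (m + 1) s l * (θ * x l) :=
              mul_le_mul_right (hexit l hl j hj) _
          _ = θ * (pow (scaled A lam) (m + 1) s l * x l) := by ring
          _ ≤ θ * x s := by gcongr; exact pow_scaled_mul_le hx m s l
      · calc _ ≤ pow (scaled A lam) (m + 1) s l * x l := by gcongr; exact scaled_mul_le hx l j
          _ ≤ θ * x s := ih l hl
  calc _ ≤ θ * x s := plus_mul_le (hpos t) fun m => hpow m t ht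
    _ < x s := mul_lt_of_lt_one_left (hpos s) hθ

theorem transGen_saturated_of_mem_critComponent (hx : x ∈ eigencone A lam) (hpos : ∀ i, 0 < x i)
    {i j : Fin n} (hi : i ∈ critNodes A lam) (h : j ∈ critComponent A lam i) :
    Relation.TransGen (Saturated A lam x) i j := by
  obtain ⟨l, hl⟩ := exists_critEdge_left hi
  -- Starting with a critical edge keeps the walk nonempty even for `j = i`, as `(A_lam)⁺` has no
  -- zeroth power.
  exact Relation.TransGen.mono (fun _ _ h => CritEdge.saturated h hx hpos) _ _
    (Relation.TransGen.head' hl (hl.reflTransGen_symm.trans h.2.1))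

/-- The columns of `(A_lam)⁺` with diagonal entry at least `1` are eigenvectors. -/
theorem plus_col_mem_eigencone (hlam : 0 < lam) (hN : ∀ i, i ∈ maxSupport A lam) {t : Fin n}
    (ht : 1 ≤ plus (scaled A lam) t t) :
    (fun i => plus (scaled A lam) i t) ∈ eigencone A lam := by
  have hA : ∀ i j, A i j = lam * scaled A lam i j := fun i j => by
    rw [scaled, if_pos (hN j), mul_div_cancel₀ _ hlam.ne']
  funext i
  simp only [mulVec, hA, mul_assoc]
  rw [← NNReal.mul_finset_sup]
  congr 1
  refine le_antisymm (Finset.sup_le fun j _ => ?_) (ciSup_le fun k => ?_)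
  · rw [plus, NNReal.mul_iSup]
    refine ciSup_le fun k => le_trans ?_ (pow_le_plus (k + 1) i t)
    rw [pow_succ_left]
    exact Finset.le_sup (f := fun l => scaled A lam i l * pow (scaled A lam) (k + 1) l t)
      (Finset.mem_univ j)
  -- The first power is not part of `A_lam ⊗ (A_lam)⁺`; the diagonal entry at `t` makes up for it.
  · cases k with
    | zero =>
      rw [pow_one_apply]
      exact (le_mul_of_one_le_right zero_le ht).trans
        (Finset.le_sup (f := fun l => scaled A lam i l * plus (scaled A lam) l t)
          (Finset.mem_univ t))
    | succ k =>
      rw [pow_succ_left]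
      exact Finset.sup_mono_fun fun l _ => by gcongr; exact pow_le_plus k l t

theorem one_le_plus_self (hN : ∀ i, i ∈ maxSupport A lam) {t : Fin n}
    (ht : t ∈ critNodes A lam) : 1 ≤ plus (scaled A lam) t t := by
  obtain ⟨x, hx, hs⟩ := exists_support_eq A lam
  have hpos : ∀ i, 0 < x i := fun i => by
    have := hN i
    rwa [← hs] at this
  have hlam : 0 < lam := by
    obtain ⟨_, _, hc, _⟩ := ht
    exact hc.lam_pos
  have h := le_plus_mul_of_transGen hlam hx hpos
    (transGen_saturated_of_mem_critComponent hx hpos ht (self_mem_critComponent ht))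
  exact le_of_mul_le_mul_right (by rwa [one_mul]) (hpos t)

theorem mulVec_mem_eigencone {ι : Type*} [Fintype ι] {M : Matrix (Fin n) ι ℝ≥0}
    (hM : ∀ t, (fun i => M i t) ∈ eigencone A lam) (z : ι → ℝ≥0) :
    mulVec M z ∈ eigencone A lam := by
  funext i
  simp only [mulVec, NNReal.mul_finset_sup]
  rw [Finset.sup_comm]
  refine Finset.sup_congr rfl fun t _ => ?_
  have h := congrFun (hM t) i
  simp only [mulVec] at h
  rw [← mul_assoc, ← h, NNReal.finset_sup_mul]
  simp only [mul_assoc]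

/-! ### Both sides in terms of saturated edges between components -/

theorem exists_saturated_exit_of_mem_span_removeCol (hN : critNodes A lam = Set.univ)
    (hcyc : ∀ i, IsCycleComponent A lam (critComponent A lam i)) (hlam : 0 < lam)
    (hx : x ∈ eigencone A lam) (hpos : ∀ i, 0 < x i) {i : Fin n} (h : x ∈ span (removeCol A i)) :
    ∃ k j, Saturated A lam x k j ∧ j ∉ critComponent A lam k := by
  have hnode : ∀ j, j ∈ critNodes A lam := fun j => hN ▸ Set.mem_univ j
  obtain ⟨y, hy⟩ := h
  have hle : ∀ p j, A p j.1 * y j ≤ x p := fun p j => by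
    rw [congrFun hy p]
    exact Finset.le_sup (f := fun j => removeCol A i p j * y j) (Finset.mem_univ j)
  -- The critical predecessor of `j` gives column `j` a positive saturated entry, which bounds its
  -- coefficient.
  have hyx : ∀ j, lam * y j ≤ x j.1 := by
    intro j
    obtain ⟨p, hp⟩ := exists_critEdge_right (hnode j.1)
    have hsat : A p j.1 * x j.1 = lam * x p := hp.saturated hx hpos
    have hA : 0 < A p j.1 := by
      refine pos_of_mul_pos_left (b := x j.1) ?_ zero_le
      rw [hsat]
      exact mul_pos hlam (hpos p)
    refine le_of_mul_le_mul_left ?_ hA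
    calc A p j.1 * (lam * y j) = lam * (A p j.1 * y j) := by ring
      _ ≤ lam * x p := by gcongr; exact hle p j
      _ = _ := hsat.symm
  obtain ⟨k, hk⟩ := exists_critEdge_right (hnode i)
  obtain ⟨j, hj⟩ := exists_eq_of_eq_sup (hpos k) (congrFun hy k)
  have hsat : Saturated A lam x k j.1 := by
    refine le_antisymm (mul_le_of_mem_eigencone hx _ _) ?_
    calc lam * x k = lam * (A k j.1 * y j) := by rw [← hj]; rfl
      _ = A k j.1 * (lam * y j) := by ring
      _ ≤ A k j.1 * x j.1 := by gcongr; exact hyx j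
  exact ⟨k, j.1, hsat, fun hmem =>
    j.2 (hk.eq_of_saturated (hcyc k) hx hpos hsat hmem).symm⟩

theorem exists_mem_span_removeCol_of_saturated_exit (hN : critNodes A lam = Set.univ)
    (hcyc : ∀ i, IsCycleComponent A lam (critComponent A lam i)) (hlam : 0 < lam)
    (hx : x ∈ eigencone A lam) (hpos : ∀ i, 0 < x i) {k j : Fin n}
    (hkj : Saturated A lam x k j) (hj : j ∉ critComponent A lam k) :
    ∃ i, x ∈ span (removeCol A i) := by
  have hnode : ∀ j, j ∈ critNodes A lam := fun j => hN ▸ Set.mem_univ j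
  obtain ⟨i, hi⟩ := exists_critEdge_left (hnode k)
  -- Only `k` has `i` as critical successor, and row `k` uses the exit `j` instead.
  have hrow : ∀ p, ∃ q, q ≠ i ∧ Saturated A lam x p q := by
    intro p
    by_cases hp : p = k
    · subst hp
      exact ⟨j, fun h => hj (h ▸ hi.mem_critComponent), hkj⟩
    · obtain ⟨q, hq⟩ := exists_critEdge_left (hnode p)
      refine ⟨q, ?_, hq.saturated hx hpos⟩
      rintro rfl
      exact hp (hi.left_unique (hcyc _) hq)
  refine ⟨i, fun q => x q.1 / lam, funext fun p => ?_⟩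
  have heq : ∀ q, A p q * (x q / lam) = A p q * x q / lam := fun q => (mul_div_assoc _ _ _).symm
  refine le_antisymm ?_ (Finset.sup_le fun q _ => ?_)
  · obtain ⟨q, hqi, hq⟩ := hrow p
    refine le_trans (le_of_eq ?_) (Finset.le_sup
      (f := fun q => removeCol A i p q * (x q.1 / lam)) (Finset.mem_univ ⟨q, hqi⟩))
    change x p = A p q * (x q / lam)
    rw [heq, hq, mul_div_cancel_left₀ _ hlam.ne']
  · change A p q.1 * (x q.1 / lam) ≤ x p
    rw [heq, div_le_iff₀ hlam, mul_comm (x p)]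
    exact mul_le_of_mem_eigencone hx _ _

theorem exists_saturated_exit_of_mem_span_genMatrix (hlam : 0 < lam) (hx : x ∈ eigencone A lam)
    (hpos : ∀ i, 0 < x i) {s : firstIndices A lam}
    (h : x ∈ span (removeCol (genMatrix A lam) s)) :
    ∃ k j, Saturated A lam x k j ∧ j ∉ critComponent A lam k := by
  obtain ⟨z, hz⟩ := h
  have hsnode := mem_critNodes_of_mem_firstIndices s.2
  obtain ⟨t, ht⟩ := exists_eq_of_eq_sup (hpos s.1) (congrFun hz s.1)
  have htnode := mem_critNodes_of_mem_firstIndices t.1.2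
  -- The diagonal entry at a critical node is at least `1`.
  have hzt : z t ≤ x t.1.1 := by
    have h1 : plus (scaled A lam) t.1.1 t.1.1 * z t ≤ x t.1.1 := by
      rw [congrFun hz t.1.1]
      exact Finset.le_sup (f := fun t' => removeCol (genMatrix A lam) s t.1.1 t' * z t')
        (Finset.mem_univ t)
    exact (le_mul_of_one_le_left zero_le
      (one_le_plus_self (fun i => ⟨x, hx, hpos i⟩) htnode)).trans h1
  have hts : t.1.1 ∉ critComponent A lam s.1 := fun hmem =>
    t.2 (Subtype.ext (firstIndices_eq_of_mem_critComponent s.2 t.1.2 hmem).symm)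
  by_contra! hno
  refine absurd (plus_mul_lt_of_no_saturated_exit hlam hx hpos (C := critComponent A lam s.1)
    (fun k hk j hj hkj => hj (mem_critComponent_trans hk (hno k j hkj)))
    (self_mem_critComponent hsnode) hts) (not_lt.2 ?_)
  rw [← ht]
  change plus (scaled A lam) s.1 t.1.1 * z t ≤ _
  gcongr

theorem exists_mem_span_genMatrix_of_saturated_exit (hN : critNodes A lam = Set.univ)
    (hlam : 0 < lam) (hx : x ∈ eigencone A lam) (hpos : ∀ i, 0 < x i) {k j : Fin n}
    (hkj : Saturated A lam x k j) (hj : j ∉ critComponent A lam k) :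
    ∃ s : firstIndices A lam, x ∈ span (removeCol (genMatrix A lam) s) := by
  have hnode : ∀ j, j ∈ critNodes A lam := fun j => hN ▸ Set.mem_univ j
  obtain ⟨s, hsK, hsk⟩ := exists_firstIndex (hnode k)
  -- Nodes in the component of `k` go round to `k`, take the exit, and go on to the generator of the
  -- component of `j`; all others use their own generator.
  have hrow : ∀ p, ∃ t ∈ firstIndices A lam, t ≠ s ∧
      Relation.TransGen (Saturated A lam x) p t := by
    intro p
    by_cases hp : p ∈ critComponent A lam k
    · obtain ⟨t, htK, htj⟩ := exists_firstIndex (hnode j)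
      refine ⟨t, htK, ?_, ?_⟩
      · rintro rfl
        exact hj (mem_critComponent_trans hsk (mem_critComponent_symm (hnode j) htj))
      · exact ((transGen_saturated_of_mem_critComponent hx hpos (hnode p)
          (mem_critComponent_symm (hnode k) hp)).tail hkj).trans
            (transGen_saturated_of_mem_critComponent hx hpos (hnode j) htj)
    · obtain ⟨t, htK, htp⟩ := exists_firstIndex (hnode p)
      refine ⟨t, htK, ?_, transGen_saturated_of_mem_critComponent hx hpos (hnode p) htp⟩
      rintro rfl
      exact hp (mem_critComponent_trans hsk (mem_critComponent_symm (hnode p) htp))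
  refine ⟨⟨s, hsK⟩, fun t => x t.1.1, funext fun p => ?_⟩
  refine le_antisymm ?_ (Finset.sup_le fun t _ => ?_)
  swap
  · change plus (scaled A lam) p t.1.1 * x t.1.1 ≤ x p
    exact plus_mul_le (hpos _) fun m => pow_scaled_mul_le hx m _ _
  obtain ⟨t, htK, hts, ht⟩ := hrow p
  have hne : (⟨t, htK⟩ : firstIndices A lam) ≠ ⟨s, hsK⟩ := fun h => hts (congrArg Subtype.val h)
  exact (le_plus_mul_of_transGen hlam hx hpos ht).trans
    (le_mulVec (removeCol (genMatrix A lam) ⟨s, hsK⟩) (fun t => x t.1.1) p ⟨⟨t, htK⟩, hne⟩)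

end MaxAlg

open MaxAlg in
theorem theoremt (n : ℕ) (A : Matrix (Fin n) (Fin n) ℝ≥0) (lam : ℝ≥0)
    (hN : MaxAlg.critNodes A lam = Set.univ)
    (hcyc : ∀ i ∈ MaxAlg.critNodes A lam,
      MaxAlg.IsCycleComponent A lam (MaxAlg.critComponent A lam i)) :
    (⋃ i : Fin n, MaxAlg.span (MaxAlg.removeCol A i)) ∩ MaxAlg.posEigencone A lam =
      ⋃ s : MaxAlg.firstIndices A lam,
        MaxAlg.posSpan (MaxAlg.removeCol (MaxAlg.genMatrix A lam) s) := by
  have hnode : ∀ j, j ∈ critNodes A lam := fun j => hN ▸ Set.mem_univ j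
  have hcyc' := fun i => hcyc i (hnode i)
  -- A node is required: for `n = 0` the hypotheses allow `lam = 0`.
  have hlam : Fin n → 0 < lam := fun i => by
    obtain ⟨_, _, hc, _⟩ := hnode i
    exact hc.lam_pos
  have hsupp : ∀ i, i ∈ maxSupport A lam := fun i => by
    obtain ⟨_, _, hc, l, rfl⟩ := hnode i
    exact hc.1.2.2 l
  ext x
  simp only [Set.mem_inter_iff, Set.mem_iUnion]
  constructor
  · rintro ⟨⟨i, hi⟩, hx, hpos⟩
    obtain ⟨k, j, hkj, hj⟩ :=
      exists_saturated_exit_of_mem_span_removeCol hN hcyc' (hlam i) hx hpos hi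
    obtain ⟨s, hs⟩ := exists_mem_span_genMatrix_of_saturated_exit hN (hlam i) hx hpos hkj hj
    exact ⟨s, hs, hpos⟩
  · rintro ⟨s, hs, hpos⟩
    have hx : x ∈ eigencone A lam := by
      obtain ⟨z, rfl⟩ := hs
      exact mulVec_mem_eigencone (fun t => plus_col_mem_eigencone (hlam s.1) hsupp
        (one_le_plus_self hsupp (hnode _))) z
    obtain ⟨k, j, hkj, hj⟩ :=
      exists_saturated_exit_of_mem_span_genMatrix (hlam s.1) hx hpos hs
    exact ⟨exists_mem_span_removeCol_of_saturated_exit hN hcyc' (hlam s.1) hx hpos hkj hj,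
      hx, hpos⟩
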